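/- Let $M_A,M_B,M_C$ be the algebras of complex $a\times a$, $b\times b$, $c\times c$ matrices, and identify $M_n(M_m)$ with $M_{nm}=M_n\otimes M_m$, so that $M_n(M_m)^+$ is the set of positive semidefinite matrices. Let $\phi:M_A\times M_B\to M_C$ be bilinear and let $p,q,r\ge 1$ be integers. Definitions. - $\phi$ is *$(p,q,r)$-positive* if for all $x=[x_{ij}]\in M_p(M_A)^+$, $y=[y_{kl}]\in M_q(M_B)^+$ and every complex $r\times pq$ matrix $\alpha$ one has $\alpha\,[\phi(x_{ij},y_{kl})]_{(i,k),(j,l)}\,\alpha^*\in M_r(M_C)^+$. A linear map $\Phi$ between matrix algebras is *$s$-positive* if its amplification $\Phi_s:[x_{ij}]\mapsto[\Phi(x_{ij})]$ maps positive matrices to positive matrices. - For $\eta\in\mathbb C^m\otimes\mathbb C^n$ let $\lambda_\eta:\mathbb C^m\to\mathbb C^n$ be the linear map depending linearly on $\eta$ with $\lambda_{v\otimes w}(u)=\big(\sum_j v_ju_j\big)w$. For $\xi=\sum_i e_i\otimes\eta_i\in\mathbb C^l\otimes\mathbb C^m\otimes\mathbb C^n$, where $(e_i)$ is the standard basis of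 $\mathbb C^l$, let $\Lambda_\xi:\mathbb C^l\to\mathcal L(\mathbb C^m,\mathbb C^n)$, $\Lambda_\xi(u)=\sum_i u_i\lambda_{\eta_i}$. Put $\alpha_\xi=\operatorname{rank}\Lambda_\xi$, $\beta_\xi=\dim\bigvee\{(\ker T)^\perp: T\in\operatorname{ran}\Lambda_\xi\}$ and $\gamma_\xi=\dim\bigvee\{\operatorname{ran}T: T\in\operatorname{ran}\Lambda_\xi\}$. - In $M_l\otimes M_m\otimes M_n$, $\mathbb S_{s,t,u}$ is the set of finite sums $\sum_i|\xi_i\rangle\langle\xi_i|$ with $\alpha_{\xi_i}\le s$, $\beta_{\xi_i}\le t$, $\gamma_{\xi_i}\le u$ for all $i$. In $M_m\otimes M_n$, $\mathbb V_s$ is the set of finite sums $\sum_i|\eta_i\rangle\langle\eta_i|$ with $\operatorname{rank}\lambda_{\eta_i}\le s$ for all $i$. - With $\langle W,\varrho\rangle=\operatorname{tr}(W\varrho^{\mathsf t})$, a Hermitian matrix $W\in M_l\otimes M_m\otimes M_n$ is *$(s,t,u)$-block-positive* if $\langle W,\varrho\rangle\ge0$ for all $\varrho\in\mathbb S_{s,t,u}$,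 and a Hermitian $W\in M_m\otimes M_n$ is *$s$-block-positive* if $\langle W,\varrho\rangle\ge 0$ for all $\varrho\in\mathbb V_s$. - $D_\phi:M_{AB}=M_A\otimes M_B\to M_C$ is the linear map with $D_\phi(x\otimes y)=\phi(x,y)$, and $E_\phi:M_A\to M_{BC}=M_B\otimes M_C$ is the linear map $E_\phi(x)=\sum_{k,l}|k\rangle\langle l|\otimes\phi(x,|k\rangle\langle l|)$. Theorem. The following are equivalent: (i) $\phi$ is $(p,q,r)$-positive; (ii) $(D_\phi)_r:M_r(M_{AB})\to M_r(M_C)$ maps $\mathbb S_{r,p,q}\subset M_r\otimes M_A\otimes M_B$ into $M_r(M_C)^+$; (iii) $(E_\phi)_p:M_p(M_A)\to M_p(M_{BC})=M_p\otimes M_B\otimes M_C$ maps positive matrices to $(p,q,r)$-block-positive matrices. Moreover: (a) $\phi$ is $(a,b,r)$-positive if and only if $D_\phi$ is $r$-positive; (b) $\phi$ is $(p,q,1)$-positive if and only if $D_\phi$ maps $\mathbb V_{\min(p,q)}\subset M_A\otimes M_B$ into $M_C^+$; (c) $\phi$ is $(p,b,c)$-positive if and only if $E_\phi$ is $p$-positive;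 (d) $\phi$ is $(1,q,r)$-positive if and only if $E_\phi$ maps $M_A^+$ to $\min(q,r)$-block-positive matrices in $M_B\otimes M_C$. -/

import Mathlib

open scoped ComplexOrder Kronecker

noncomputable section

namespace TriPos

/-- `M_n`, the complex matrices with rows and columns indexed by `ι`. -/
abbrev Mat (ι : Type) : Type := Matrix ι ι ℂ

/-- `M_n(M_m)`: block matrices whose entries are complex matrices. -/
abbrev BlockMat (n : ℕ) (κ : Type) : Type := Matrix (Fin n) (Fin n) (Mat κ)

/-- The identification `M_n(M_m) ≃ M_{nm}`. -/
abbrev flatten {n : ℕ} {κ : Type} : BlockMat n κ ≃ Mat (Fin n × κ) :=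
  Matrix.comp (Fin n) (Fin n) κ κ ℂ

/-- The positive cone `M_n(M_m)⁺` of the matrix algebra `M_m`. -/
def IsPos {n : ℕ} {κ : Type} (x : BlockMat n κ) : Prop :=
  (flatten x).PosSemidef

/-- `M_A × M_B → M_C` bilinear, with `M_A`, `M_B`, `M_C` of sizes `a`, `b`, `c`. -/
abbrev Bilin (a b c : ℕ) : Type :=
  Mat (Fin a) →ₗ[ℂ] Mat (Fin b) →ₗ[ℂ] Mat (Fin c)

/-- `φ_{p,q}(x, y) = [φ(x_{i,j}, y_{k,l})]`, with rows `(i,k)` and columns `(j,l)`. -/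
def biAmp {a b c p q : ℕ} (φ : Bilin a b c)
    (x : BlockMat p (Fin a)) (y : BlockMat q (Fin b)) :
    Matrix (Fin p × Fin q) (Fin p × Fin q) (Mat (Fin c)) :=
  Matrix.of fun s t => φ (x s.1 t.1) (y s.2 t.2)

/-- `α z α*` for a scalar rectangular matrix `α` and a block matrix `z`. -/
def compress {σ : Type} [Fintype σ] {r : ℕ} {κ : Type}
    (α : Matrix (Fin r) σ ℂ) (z : Matrix σ σ (Mat κ)) : BlockMat r κ :=
  Matrix.of fun i j => ∑ s, ∑ t, (α i s * star (α j t)) • z s t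

/-- `(p,q,r)`-positivity of a bilinear map between matrix algebras. -/
def IsPositive {a b c : ℕ} (φ : Bilin a b c) (p q r : ℕ) : Prop :=
  ∀ (x : BlockMat p (Fin a)) (y : BlockMat q (Fin b)) (α : Matrix (Fin r) (Fin p × Fin q) ℂ),
    IsPos x → IsPos y → IsPos (compress α (biAmp φ x y))

/-- The amplification `Φ_n = id ⊗ Φ : M_n(M_m) → M_n(M_k)` of a linear map. -/
def amp {κ τ : Type} (Φ : Mat κ →ₗ[ℂ] Mat τ) {n : ℕ} (x : BlockMat n κ) : BlockMat n τ :=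
  x.map Φ

/-- `s`-positivity of a linear map between matrix algebras. -/
def IsSPositive {κ τ : Type} (Φ : Mat κ →ₗ[ℂ] Mat τ) (s : ℕ) : Prop :=
  ∀ x : BlockMat s κ, IsPos x → IsPos (amp Φ x)

/-- The linear map `D_φ : M_{AB} → M_C` with `D_φ (x ⊗ y) = φ (x, y)`. -/
def mapD {a b c : ℕ} (φ : Bilin a b c) : Mat (Fin a × Fin b) →ₗ[ℂ] Mat (Fin c) where
  toFun X := ∑ i, ∑ j, ∑ k, ∑ l,
    X (i, k) (j, l) • φ (Matrix.single i j 1) (Matrix.single k l 1)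
  map_add' X Y := by simp [add_smul, Finset.sum_add_distrib]
  map_smul' t X := by simp [mul_smul, Finset.smul_sum]

/-- The linear map `E_φ : M_A → M_{BC}`, `E_φ x = ∑_{k,l} |k⟩⟨l| ⊗ φ (x, |k⟩⟨l|)`. -/
def mapE {a b c : ℕ} (φ : Bilin a b c) : Mat (Fin a) →ₗ[ℂ] Mat (Fin b × Fin c) where
  toFun x := Matrix.of fun s t => φ x (Matrix.single s.1 t.1 1) s.2 t.2
  map_add' x y := by ext s t; simp
  map_smul' t x := by ext s t; simp

/-- The bilinear pairing `⟨W, ϱ⟩ = tr (W ϱᵀ)` of matrices. -/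
def pairing {ι : Type} [Fintype ι] (W ϱ : Mat ι) : ℂ := (W * ϱ.transpose).trace

/-- The rank one matrix `|ξ⟩⟨ξ|`. -/
def ketBra {ι : Type} (ξ : ι → ℂ) : Mat ι := Matrix.vecMulVec ξ (star ξ)

/-- The linear map `λ_η : ℂ^m → ℂ^n` of a vector `η ∈ ℂ^m ⊗ ℂ^n`; for `η = v ⊗ w` it sends `u` to
`(∑_j v_j u_j) w`. -/
def lam {m n : ℕ} (η : Fin m × Fin n → ℂ) :
    EuclideanSpace ℂ (Fin m) →ₗ[ℂ] EuclideanSpace ℂ (Fin n) :=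
  Matrix.toEuclideanLin (Matrix.of fun k j => η (j, k))

/-- The linear map `Λ_ξ : ℂ^l → L(ℂ^m, ℂ^n)` of `ξ ∈ ℂ^l ⊗ ℂ^m ⊗ ℂ^n`; writing
`ξ = ∑_i |i⟩ ⊗ η_i`, it sends `u` to `∑_i u_i λ_{η_i}`. -/
def Lam {l m n : ℕ} (ξ : Fin l × Fin m × Fin n → ℂ) :
    EuclideanSpace ℂ (Fin l) →ₗ[ℂ]
      (EuclideanSpace ℂ (Fin m) →ₗ[ℂ] EuclideanSpace ℂ (Fin n)) where
  toFun u := ∑ i, u i • lam (fun s => ξ (i, s))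
  map_add' u v := by simp [add_smul, Finset.sum_add_distrib]
  map_smul' t u := by simp [mul_smul, Finset.smul_sum]

/-- The first Schmidt rank: `rank Λ_ξ`. -/
def srA {l m n : ℕ} (ξ : Fin l × Fin m × Fin n → ℂ) : ℕ :=
  Module.finrank ℂ (LinearMap.range (Lam ξ))

/-- The second Schmidt rank: the dimension of the join of the supports (orthogonal complements of
kernels) of the maps in the range of `Λ_ξ`. -/
def srB {l m n : ℕ} (ξ : Fin l × Fin m × Fin n → ℂ) : ℕ :=
  Module.finrank ℂ
    (⨆ T ∈ LinearMap.range (Lam ξ), (LinearMap.ker T)ᗮ :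
      Submodule ℂ (EuclideanSpace ℂ (Fin m)))

/-- The third Schmidt rank: the dimension of the join of the ranges of the maps in the range
of `Λ_ξ`. -/
def srC {l m n : ℕ} (ξ : Fin l × Fin m × Fin n → ℂ) : ℕ :=
  Module.finrank ℂ
    (⨆ T ∈ LinearMap.range (Lam ξ), LinearMap.range T :
      Submodule ℂ (EuclideanSpace ℂ (Fin n)))

/-- The cone `𝕊_{p,q,r}` of tri-partite unnormalized states in `M_l ⊗ M_m ⊗ M_n` with Schmidt
number at most `(p,q,r)`. -/
def stateCone (l m n p q r : ℕ) : Set (Mat (Fin l × Fin m × Fin n)) :=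
  {ϱ | ∃ (N : ℕ) (ξ : Fin N → Fin l × Fin m × Fin n → ℂ),
    (∀ i, srA (ξ i) ≤ p ∧ srB (ξ i) ≤ q ∧ srC (ξ i) ≤ r) ∧ ϱ = ∑ i, ketBra (ξ i)}

/-- `(p,q,r)`-block positivity of a tri-partite Hermitian matrix. -/
def IsBlockPos {l m n : ℕ} (W : Mat (Fin l × Fin m × Fin n)) (p q r : ℕ) : Prop :=
  W.IsHermitian ∧ ∀ ϱ ∈ stateCone l m n p q r, 0 ≤ pairing W ϱ

/-- The cone `𝕍_s` of bi-partite unnormalized states in `M_m ⊗ M_n` with Schmidt number at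
most `s`. -/
def biStateCone (m n s : ℕ) : Set (Mat (Fin m × Fin n)) :=
  {ϱ | ∃ (N : ℕ) (η : Fin N → Fin m × Fin n → ℂ),
    (∀ i, Module.finrank ℂ (LinearMap.range (lam (η i))) ≤ s) ∧ ϱ = ∑ i, ketBra (η i)}

/-- `s`-block positivity of a bi-partite Hermitian matrix. -/
def IsBiBlockPos {m n : ℕ} (W : Mat (Fin m × Fin n)) (s : ℕ) : Prop :=
  W.IsHermitian ∧ ∀ ϱ ∈ biStateCone m n s, 0 ≤ pairing W ϱ

/-- `D_φ` is the linearization of `φ`. -/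
theorem mapD_kronecker {a b c : ℕ} (φ : Bilin a b c) (x : Mat (Fin a)) (y : Mat (Fin b)) :
    mapD φ (x ⊗ₖ y) = φ x y := by
  have h : ∀ {n : ℕ} (i j : Fin n) (t : ℂ),
      (Matrix.single i j t : Mat (Fin n)) = t • Matrix.single i j (1 : ℂ) := by
    intro n i j t; simp [Matrix.smul_single]
  have hx : φ x y = ∑ i, ∑ j, x i j • φ (Matrix.single i j 1) y := by
    conv_lhs => rw [Matrix.matrix_eq_sum_single x]
    simp only [map_sum, LinearMap.coe_sum, Finset.sum_apply]
    refine Finset.sum_congr rfl fun i _ => Finset.sum_congr rfl fun j _ => ?_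
    rw [h, map_smul, LinearMap.smul_apply]
  have hy : ∀ i j, φ (Matrix.single i j 1) y =
      ∑ k, ∑ l, y k l • φ (Matrix.single i j 1) (Matrix.single k l 1) := by
    intro i j
    conv_lhs => rw [Matrix.matrix_eq_sum_single y]
    simp only [map_sum]
    refine Finset.sum_congr rfl fun k _ => Finset.sum_congr rfl fun l _ => ?_
    rw [h k l, map_smul]
  rw [hx]
  simp only [hy, mapD, LinearMap.coe_mk, AddHom.coe_mk, Matrix.kroneckerMap_apply,
    Finset.smul_sum, smul_smul]

/-- `E_φ x` represents the functional `y ⊗ z ↦ tr (φ(x, y) zᵀ)` on `M_{BC}`. -/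
theorem pairing_mapE {a b c : ℕ} (φ : Bilin a b c) (x : Mat (Fin a)) (y : Mat (Fin b))
    (z : Mat (Fin c)) : pairing (mapE φ x) (y ⊗ₖ z) = pairing (φ x y) z := by
  have h : ∀ k l (t : ℂ), (Matrix.single k l t : Mat (Fin b)) = t • Matrix.single k l (1 : ℂ) := by
    intro k l t; simp [Matrix.smul_single]
  have hy : φ x y = ∑ k, ∑ l, y k l • φ x (Matrix.single k l 1) := by
    conv_lhs => rw [Matrix.matrix_eq_sum_single y]
    simp only [map_sum]
    refine Finset.sum_congr rfl fun k _ => Finset.sum_congr rfl fun l _ => ?_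
    rw [h, map_smul]
  rw [hy]
  simp only [pairing, mapE, Matrix.trace, Matrix.diag, Matrix.mul_apply, Matrix.transpose_apply,
    Matrix.kroneckerMap_apply, LinearMap.coe_mk, AddHom.coe_mk, Matrix.of_apply,
    Fintype.sum_prod_type, Matrix.sum_apply, Matrix.smul_apply, smul_eq_mul, Finset.sum_mul]
  rw [Finset.sum_comm]
  refine Finset.sum_congr rfl fun m _ => ?_
  conv_rhs => rw [Finset.sum_comm]
  refine Finset.sum_congr rfl fun k _ => ?_
  conv_rhs => rw [Finset.sum_comm]
  refine Finset.sum_congr rfl fun l _ => Finset.sum_congr rfl fun n _ => ?_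
  ring

end TriPos

end

open TriPos

/-! Positive matrices are sums of rank-one ones, so in the definition of positivity one may take `x
= |v⟩⟨v|` and `y = |w⟩⟨w|`; the compressed matrix is then `(D_φ)_r(|ξ⟩⟨ξ|)` with `ξ = tensor α v w`
(`compress_biAmp_ketBra`). The vectors of this form are exactly those with second and third Schmidt
ranks at most `p` and `q` (`srB_tensor_le`, `srC_tensor_le`, `exists_eq_tensor`), while the first
rank never exceeds the outer dimension. This gives (ii). For (iii) only `y` is decomposed, and
positivity is tested against vectors `z`. Reading `α` as a tensor with three legs, the same number
is a pairing of `(E_φ)_p(x)` with a vector of Schmidt ranks at most `(p,q,r)` (`pairing_amp_mapE`).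
Hermiticity comes from `φ` commuting with adjoints. In (a) and (c) the rank bounds hold for every
vector; in (b) and (d) the outer space is one-dimensional and both remaining ranks equal `rank λ_η`,
whence the minimum. -/

namespace TriPos

/-! ### Rank-one generation and self-duality of the positive cone. -/

section Cone

variable {ι : Type} [Fintype ι]

theorem posSemidef_ketBra (ξ : ι → ℂ) : (ketBra ξ).PosSemidef :=
  Matrix.posSemidef_vecMulVec_self_star ξ

theorem posSemidef_induction {P : Mat ι → Prop} (zero : P 0) (add : ∀ X Y, P X → P Y → P (X + Y))
    (ket : ∀ ξ, P (ketBra ξ)) {X : Mat ι} (hX : X.PosSemidef) : P X := by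
  classical
  obtain ⟨B, rfl⟩ : ∃ B : Mat ι, X = B.conjTranspose * B := by
    open scoped MatrixOrder in
    exact CStarAlgebra.nonneg_iff_eq_star_mul_self.mp (Matrix.nonneg_iff_posSemidef.mpr hX)
  -- The rank-one summands come from the conjugated rows of `B`.
  have h : B.conjTranspose * B = ∑ k, ketBra (fun s => star (B k s)) := by
    ext s t
    simp [ketBra, Matrix.mul_apply, Matrix.sum_apply, Matrix.vecMulVec_apply]
  rw [h]
  exact Finset.sum_induction _ P add zero fun k _ => ket _

theorem pairing_eq_sum (W ϱ : Mat ι) : pairing W ϱ = ∑ s, ∑ t, W s t * ϱ s t := by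
  simp [pairing, Matrix.trace, Matrix.mul_apply]

theorem pairing_ketBra (W : Mat ι) (ξ : ι → ℂ) :
    pairing W (ketBra ξ) = ∑ s, ∑ t, W s t * (ξ s * star (ξ t)) := by
  simp [pairing_eq_sum, ketBra, Matrix.vecMulVec_apply]

theorem pairing_sum_right {κ : Type} [Fintype κ] (W : Mat ι) (ϱ : κ → Mat ι) :
    pairing W (∑ i, ϱ i) = ∑ i, pairing W (ϱ i) := by
  simp [pairing, Matrix.transpose_sum, Finset.mul_sum, Matrix.trace_sum]

theorem posSemidef_iff_pairing_nonneg {W : Mat ι} :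
    W.PosSemidef ↔ ∀ ξ : ι → ℂ, 0 ≤ pairing W (ketBra ξ) := by
  classical
  have key : ∀ x : ι → ℂ, pairing W (ketBra (star x)) = star x ⬝ᵥ (W.mulVec x) := by
    intro x
    rw [pairing_ketBra]
    simp only [dotProduct, Matrix.mulVec, Finset.mul_sum, Pi.star_apply, star_star]
    exact Finset.sum_congr rfl fun s _ => Finset.sum_congr rfl fun t _ => by ring
  constructor
  · intro h ξ
    rw [← star_star ξ, key]
    exact h.dotProduct_mulVec_nonneg _
  · intro h
    refine .of_dotProduct_mulVec_nonneg ?_ fun x => key x ▸ h _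
    -- Nonnegativity in `ℂ` includes being real, and a real quadratic form over `ℂ` forces `W` to be
    -- Hermitian.
    rw [← Matrix.isSymmetric_toEuclideanLin_iff, LinearMap.isSymmetric_iff_inner_map_self_real]
    intro v
    have h1 := h (star v.ofLp)
    rw [key] at h1
    rw [Complex.conj_eq_iff_im]
    have h2 : inner ℂ (W.toEuclideanLin v) v = star (star v.ofLp ⬝ᵥ (W.mulVec v.ofLp)) := by
      rw [← inner_conj_symm, EuclideanSpace.inner_eq_star_dotProduct, dotProduct_comm]
      simp
    rw [h2, Complex.star_def, Complex.conj_im, ← (Complex.nonneg_iff.mp h1).2, neg_zero]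

end Cone

/-! ### Schmidt ranks and factorization of tripartite vectors. -/

/-- The vector `∑_{i,k} (∑_m α_{m,(i,k)} |m⟩) ⊗ v_i ⊗ w_k`. -/
def tensor {μ π κ σ τ : Type} [Fintype π] [Fintype κ] (α : Matrix μ (π × κ) ℂ)
    (v : π × σ → ℂ) (w : κ × τ → ℂ) : μ × σ × τ → ℂ :=
  fun s => ∑ i, ∑ k, α s.1 (i, k) * v (i, s.2.1) * w (k, s.2.2)

section Schmidt

theorem exists_comp_eq_starProjection {m q : ℕ} (S : Submodule ℂ (EuclideanSpace ℂ (Fin m)))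
    (hS : Module.finrank ℂ S ≤ q) :
    ∃ (f : EuclideanSpace ℂ (Fin m) →ₗ[ℂ] EuclideanSpace ℂ (Fin q))
      (g : EuclideanSpace ℂ (Fin q) →ₗ[ℂ] EuclideanSpace ℂ (Fin m)),
      ∀ x, g (f x) = S.starProjection x := by
  obtain ⟨i, hi⟩ : ∃ i : S →ₗ[ℂ] EuclideanSpace ℂ (Fin q), Function.Injective i := by
    have hv := (PiLp.basisFun 2 ℂ (Fin q)).linearIndependent.comp _ (Fin.castLE_injective hS)
    exact ⟨(Module.finBasis ℂ S).constr ℂ _, (Module.finBasis ℂ S).injective_constr_of_linearIndependent hv⟩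
  obtain ⟨j, hj⟩ := i.exists_leftInverse_of_injective (LinearMap.ker_eq_bot.mpr hi)
  refine ⟨i ∘ₗ S.orthogonalProjectionOnto.toLinearMap, S.subtype ∘ₗ j, fun x => ?_⟩
  have := LinearMap.congr_fun hj (S.orthogonalProjectionOnto x)
  simp only [LinearMap.comp_apply, LinearMap.id_apply] at this
  simp [this]

theorem lam_mem_range_Lam {l m n : ℕ} (ξ : Fin l × Fin m × Fin n → ℂ) (i : Fin l) :
    lam (fun s => ξ (i, s)) ∈ LinearMap.range (Lam ξ) := by
  refine ⟨EuclideanSpace.single i 1, ?_⟩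
  simp [Lam]

theorem srA_le {l m n : ℕ} (ξ : Fin l × Fin m × Fin n → ℂ) : srA ξ ≤ l := by
  simpa [srA] using (Lam ξ).finrank_range_le

/-- Every slice factors through `ℂ^q` and `ℂ^r`, and only the middle map depends on `i`. Both rank
bounds for `tensor` follow from the two fixed outer maps. -/
theorem lam_tensor {l m n q r : ℕ} (β : Matrix (Fin l) (Fin q × Fin r) ℂ)
    (w : Fin q × Fin m → ℂ) (z : Fin r × Fin n → ℂ) (i : Fin l) :
    lam (fun s => tensor β w z (i, s)) = lam z ∘ₗ
      Matrix.toEuclideanLin (Matrix.of fun t s => β i (s, t)) ∘ₗ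
      Matrix.toEuclideanLin (Matrix.of fun s j => w (s, j)) := by
  unfold lam
  rw [← Matrix.toLpLin_mul, ← Matrix.toLpLin_mul]
  congr 1
  ext k j
  simp only [tensor, Matrix.of_apply, Matrix.mul_apply, Finset.mul_sum]
  rw [Finset.sum_comm]
  exact Finset.sum_congr rfl fun t _ => Finset.sum_congr rfl fun s _ => by ring

theorem srB_tensor_le {l m n q r : ℕ} (β : Matrix (Fin l) (Fin q × Fin r) ℂ)
    (w : Fin q × Fin m → ℂ) (z : Fin r × Fin n → ℂ) : srB (tensor β w z) ≤ q := by
  set f := Matrix.toEuclideanLin (Matrix.of fun s j => w (s, j)) with hf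
  -- Every `T` in the range kills `ker f`, and the orthogonal complement of `ker f` has dimension
  -- `rank f ≤ q`.
  have h : (⨆ T ∈ LinearMap.range (Lam (tensor β w z)), (LinearMap.ker T)ᗮ) ≤
      (LinearMap.ker f)ᗮ := by
    refine iSup₂_le fun T hT => Submodule.orthogonal_le ?_
    obtain ⟨u, rfl⟩ := hT
    intro x hx
    rw [LinearMap.mem_ker] at hx
    simp [Lam, lam_tensor, LinearMap.sum_apply, ← hf, hx]
  refine (Submodule.finrank_mono h).trans ?_
  have h1 := (LinearMap.ker f).finrank_add_finrank_orthogonal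
  have h2 := f.finrank_range_add_finrank_ker
  have h3 := Submodule.finrank_le (LinearMap.range f)
  rw [finrank_euclideanSpace_fin] at h3
  omega

theorem srC_tensor_le {l m n q r : ℕ} (β : Matrix (Fin l) (Fin q × Fin r) ℂ)
    (w : Fin q × Fin m → ℂ) (z : Fin r × Fin n → ℂ) : srC (tensor β w z) ≤ r := by
  have h : (⨆ T ∈ LinearMap.range (Lam (tensor β w z)), LinearMap.range T) ≤
      LinearMap.range (lam z) := by
    refine iSup₂_le fun T hT => ?_
    obtain ⟨u, rfl⟩ := hT
    rintro _ ⟨x, rfl⟩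
    simp only [Lam, lam_tensor, LinearMap.coe_mk, AddHom.coe_mk, LinearMap.sum_apply,
      LinearMap.smul_apply, LinearMap.comp_apply]
    exact Submodule.sum_mem _ fun i _ => Submodule.smul_mem _ _ (LinearMap.mem_range_self _ _)
  refine (Submodule.finrank_mono h).trans ?_
  simpa using (lam z).finrank_range_le

theorem lam_injective {m n : ℕ} : Function.Injective (lam (m := m) (n := n)) := by
  intro η η' h
  have := Matrix.toEuclideanLin.injective h
  ext ⟨j, k⟩
  exact congrFun (congrFun this k) j

/-- Each slice is unchanged when composed with the projections onto the joint support and the joint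
range; these projections factor through `ℂ^q` and `ℂ^r`, which yields `w` and `z`, and the
compressed slices form `β`. -/
theorem exists_eq_tensor {l m n q r : ℕ} {ξ : Fin l × Fin m × Fin n → ℂ}
    (hB : srB ξ ≤ q) (hC : srC ξ ≤ r) :
    ∃ (β : Matrix (Fin l) (Fin q × Fin r) ℂ) (w : Fin q × Fin m → ℂ) (z : Fin r × Fin n → ℂ),
      ξ = tensor β w z := by
  obtain ⟨f, g, hfg⟩ := exists_comp_eq_starProjection _ hB
  obtain ⟨f', g', hfg'⟩ := exists_comp_eq_starProjection _ hC
  have fact : ∀ i, lam (fun s => ξ (i, s)) =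
      g' ∘ₗ (f' ∘ₗ lam (fun s => ξ (i, s)) ∘ₗ g) ∘ₗ f := by
    intro i
    set T := lam (fun s => ξ (i, s)) with hT
    have hmem : T ∈ LinearMap.range (Lam ξ) := lam_mem_range_Lam ξ i
    ext1 x
    simp only [LinearMap.comp_apply, hfg, hfg']
    have h1 := le_iSup₂_of_le (f := fun T (_ : T ∈ LinearMap.range (Lam ξ)) => (LinearMap.ker T)ᗮ)
      T hmem le_rfl
    have h2 := le_iSup₂_of_le (f := fun T (_ : T ∈ LinearMap.range (Lam ξ)) => LinearMap.range T)
      T hmem le_rfl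
    have h3 := Submodule.orthogonal_le h1
    rw [Submodule.orthogonal_orthogonal] at h3
    -- The component of `x` orthogonal to the joint support lies in `ker T`.
    have h4 := h3 (Submodule.sub_starProjection_mem_orthogonal x)
    rw [LinearMap.mem_ker, map_sub, sub_eq_zero] at h4
    rw [← h4, Submodule.starProjection_eq_self_iff.mpr (h2 (LinearMap.mem_range_self T x))]
  refine ⟨Matrix.of fun i st => Matrix.toEuclideanLin.symm (f' ∘ₗ lam (fun s => ξ (i, s)) ∘ₗ g) st.2 st.1,
    fun sj => Matrix.toEuclideanLin.symm f sj.1 sj.2,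
    fun tk => Matrix.toEuclideanLin.symm g' tk.2 tk.1, ?_⟩
  ext ⟨i, s⟩
  refine congrFun (lam_injective (a₁ := fun s => ξ (i, s))
    (a₂ := fun s => tensor _ _ _ (i, s)) ?_) s
  refine ((fact i).trans ?_).trans (lam_tensor _ _ _ i).symm
  congr 1
  · exact (Matrix.toEuclideanLin.apply_symm_apply g').symm
  · congr 1
    · exact (Matrix.toEuclideanLin.apply_symm_apply _).symm
    · exact (Matrix.toEuclideanLin.apply_symm_apply f).symm

/-- With outer dimension one the joins run over multiples of a single map, so the second and third
ranks both become its rank. -/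
theorem range_Lam_one {m n : ℕ} (η : Fin m × Fin n → ℂ) :
    LinearMap.range (Lam fun s : Fin 1 × Fin m × Fin n => η s.2) = Submodule.span ℂ {lam η} := by
  ext T
  rw [Submodule.mem_span_singleton]
  constructor
  · rintro ⟨u, rfl⟩
    exact ⟨u 0, by simp [Lam]⟩
  · rintro ⟨t, rfl⟩
    exact Submodule.smul_mem _ _ (lam_mem_range_Lam (fun s : Fin 1 × Fin m × Fin n => η s.2) 0)

theorem srB_one {m n : ℕ} (η : Fin m × Fin n → ℂ) :
    srB (fun s : Fin 1 × Fin m × Fin n => η s.2) =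
      Module.finrank ℂ (LinearMap.range (lam η)) := by
  have h : (⨆ T ∈ Submodule.span ℂ {lam η}, (LinearMap.ker T)ᗮ) = (LinearMap.ker (lam η))ᗮ := by
    refine le_antisymm (iSup₂_le fun T hT => Submodule.orthogonal_le ?_)
      (le_iSup₂_of_le _ (Submodule.mem_span_singleton_self _) le_rfl)
    obtain ⟨t, rfl⟩ := Submodule.mem_span_singleton.mp hT
    exact fun x hx => by simp_all
  rw [srB, range_Lam_one, h]
  have h1 := (LinearMap.ker (lam η)).finrank_add_finrank_orthogonal
  have h2 := (lam η).finrank_range_add_finrank_ker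
  omega

theorem srC_one {m n : ℕ} (η : Fin m × Fin n → ℂ) :
    srC (fun s : Fin 1 × Fin m × Fin n => η s.2) =
      Module.finrank ℂ (LinearMap.range (lam η)) := by
  have h : (⨆ T ∈ Submodule.span ℂ {lam η}, LinearMap.range T) = LinearMap.range (lam η) := by
    refine le_antisymm (iSup₂_le fun T hT => ?_)
      (le_iSup₂_of_le _ (Submodule.mem_span_singleton_self _) le_rfl)
    obtain ⟨t, rfl⟩ := Submodule.mem_span_singleton.mp hT
    rintro _ ⟨x, rfl⟩
    exact Submodule.smul_mem _ _ (LinearMap.mem_range_self _ x)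
  rw [srC, range_Lam_one, h]

end Schmidt

/-! ### Reduction to rank-one inputs and the map `D_φ`. -/

variable {a b c p q r : ℕ}

theorem biAmp_add_left (φ : Bilin a b c) (x x' : BlockMat p (Fin a)) (y : BlockMat q (Fin b)) :
    biAmp φ (x + x') y = biAmp φ x y + biAmp φ x' y := by
  ext s t : 2
  simp [biAmp]

theorem biAmp_add_right (φ : Bilin a b c) (x : BlockMat p (Fin a)) (y y' : BlockMat q (Fin b)) :
    biAmp φ x (y + y') = biAmp φ x y + biAmp φ x y' := by
  ext s t : 2
  simp [biAmp]

theorem compress_add {σ κ : Type} [Fintype σ] (α : Matrix (Fin r) σ ℂ)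
    (z z' : Matrix σ σ (Mat κ)) : compress α (z + z') = compress α z + compress α z' := by
  ext i j : 2
  simp [compress, Finset.sum_add_distrib]

theorem compress_zero {σ κ : Type} [Fintype σ] (α : Matrix (Fin r) σ ℂ) :
    compress α (0 : Matrix σ σ (Mat κ)) = 0 := by
  ext i j : 2
  simp [compress]

theorem isPos_zero {n : ℕ} {κ : Type} : IsPos (0 : BlockMat n κ) :=
  Matrix.PosSemidef.zero

theorem IsPos.add {n : ℕ} {κ : Type} {x y : BlockMat n κ} (hx : IsPos x) (hy : IsPos y) :
    IsPos (x + y) :=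
  Matrix.PosSemidef.add hx hy

theorem isPos_induction {n : ℕ} {κ : Type} [Fintype κ] {P : BlockMat n κ → Prop} (zero : P 0)
    (add : ∀ x y, P x → P y → P (x + y)) (ket : ∀ v, P (flatten.symm (ketBra v)))
    {x : BlockMat n κ} (hx : IsPos x) : P x := by
  have := posSemidef_induction (P := fun X => P (flatten.symm X)) zero (fun X Y => add _ _) ket hx
  simpa using this

/-- Only `y` is reduced, since the criterion for `E_φ` keeps `x` arbitrary. -/
theorem isPositive_iff_right (φ : Bilin a b c) : IsPositive φ p q r ↔
    ∀ (x : BlockMat p (Fin a)) (w : Fin q × Fin b → ℂ) (α : Matrix (Fin r) (Fin p × Fin q) ℂ),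
      IsPos x → IsPos (compress α (biAmp φ x (flatten.symm (ketBra w)))) := by
  refine ⟨fun h x w α hx => h x _ α hx (posSemidef_ketBra w), fun h x y α hx hy => ?_⟩
  refine isPos_induction (P := fun y => IsPos (compress α (biAmp φ x y))) ?_ ?_
    (fun w => h x w α hx) hy
  · have : biAmp φ x (0 : BlockMat q (Fin b)) = 0 := by ext s t : 2; simp [biAmp]
    rw [this, compress_zero]
    exact isPos_zero
  · intro y y' h1 h2
    rw [biAmp_add_right, compress_add]
    exact h1.add h2

theorem isPositive_iff_ketBra (φ : Bilin a b c) : IsPositive φ p q r ↔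
    ∀ (v : Fin p × Fin a → ℂ) (w : Fin q × Fin b → ℂ) (α : Matrix (Fin r) (Fin p × Fin q) ℂ),
      IsPos (compress α (biAmp φ (flatten.symm (ketBra v)) (flatten.symm (ketBra w)))) := by
  rw [isPositive_iff_right]
  refine ⟨fun h v w α => h _ w α (posSemidef_ketBra v), fun h x w α hx => ?_⟩
  refine isPos_induction (P := fun x => IsPos (compress α (biAmp φ x _))) ?_ ?_
    (fun v => h v w α) hx
  · have : biAmp φ (0 : BlockMat p (Fin a)) (flatten.symm (ketBra w)) = 0 := by
      ext s t : 2; simp [biAmp]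
    rw [this, compress_zero]
    exact isPos_zero
  · intro y y' h1 h2
    rw [biAmp_add_left, compress_add]
    exact h1.add h2

theorem compress_biAmp_ketBra (φ : Bilin a b c) (v : Fin p × Fin a → ℂ) (w : Fin q × Fin b → ℂ)
    (α : Matrix (Fin r) (Fin p × Fin q) ℂ) :
    compress α (biAmp φ (flatten.symm (ketBra v)) (flatten.symm (ketBra w))) =
      amp (mapD φ) (flatten.symm (ketBra (tensor α v w))) := by
  ext i j : 2
  have h : (flatten.symm (ketBra (tensor α v w)) : BlockMat r (Fin a × Fin b)) i j =
      ∑ s, ∑ t, (α i s * star (α j t)) •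
        ((flatten.symm (ketBra v) : BlockMat p (Fin a)) s.1 t.1 ⊗ₖ
          (flatten.symm (ketBra w) : BlockMat q (Fin b)) s.2 t.2) := by
    ext e f
    simp only [flatten, Matrix.comp_symm_apply, ketBra, Matrix.vecMulVec_apply, tensor,
      Pi.star_apply, star_sum, star_mul', Matrix.sum_apply, Matrix.smul_apply, smul_eq_mul,
      Matrix.kroneckerMap_apply, ← Fintype.sum_prod_type', Finset.sum_mul_sum]
    exact Finset.sum_congr rfl fun s _ => by ring
  rw [amp, Matrix.map_apply, h]
  simp only [compress, biAmp, Matrix.of_apply, map_sum, map_smul, mapD_kronecker]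

theorem isPositive_iff_tensor (φ : Bilin a b c) : IsPositive φ p q r ↔
    ∀ (v : Fin p × Fin a → ℂ) (w : Fin q × Fin b → ℂ) (α : Matrix (Fin r) (Fin p × Fin q) ℂ),
      IsPos (amp (mapD φ) (flatten.symm (ketBra (tensor α v w)))) := by
  simp only [isPositive_iff_ketBra, compress_biAmp_ketBra]

theorem isPositive_iff_schmidt (φ : Bilin a b c) : IsPositive φ p q r ↔
    ∀ ξ : Fin r × Fin a × Fin b → ℂ, srB ξ ≤ p → srC ξ ≤ q →
      IsPos (amp (mapD φ) (flatten.symm (ketBra ξ))) := by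
  rw [isPositive_iff_tensor]
  constructor
  · intro h ξ hB hC
    obtain ⟨α, v, w, rfl⟩ := exists_eq_tensor hB hC
    exact h v w α
  · exact fun h v w α => h _ (srB_tensor_le α v w) (srC_tensor_le α v w)

/-! ### The dual criterion for `E_φ`. -/

/-- Moves the outer index of a matrix into its column index. -/
def swapOuter (α : Matrix (Fin r) (Fin p × Fin q) ℂ) : Matrix (Fin p) (Fin q × Fin r) ℂ :=
  Matrix.of fun i s => α s.2 (i, s.1)

theorem mapE_linear_right (φ : Bilin a b c) (x : Mat (Fin a)) (y : Mat (Fin b)) (m n : Fin c) :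
    φ x y m n = ∑ k, ∑ l, y k l * mapE φ x (k, m) (l, n) := by
  have h : ∀ k l (t : ℂ), (Matrix.single k l t : Mat (Fin b)) = t • Matrix.single k l (1 : ℂ) := by
    intro k l t; simp [Matrix.smul_single]
  conv_lhs => rw [Matrix.matrix_eq_sum_single y]
  simp only [map_sum, Matrix.sum_apply]
  refine Finset.sum_congr rfl fun k _ => Finset.sum_congr rfl fun l _ => ?_
  rw [h, map_smul]
  rfl

theorem pairing_amp_mapE (φ : Bilin a b c) (x : BlockMat p (Fin a)) (w : Fin q × Fin b → ℂ)
    (z : Fin r × Fin c → ℂ) (α : Matrix (Fin r) (Fin p × Fin q) ℂ) :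
    pairing (flatten (amp (mapE φ) x)) (ketBra (tensor (swapOuter α) w z)) =
      pairing (flatten (compress α (biAmp φ x (flatten.symm (ketBra w))))) (ketBra z) := by
  have hL : pairing (flatten (amp (mapE φ) x)) (ketBra (tensor (swapOuter α) w z)) =
      ∑ d : ((Fin p × Fin b × Fin c) × (Fin p × Fin b × Fin c)) × (Fin q × Fin r) × (Fin q × Fin r),
        mapE φ (x d.1.1.1 d.1.2.1) d.1.1.2 d.1.2.2 *
          (α d.2.1.2 (d.1.1.1, d.2.1.1) * w (d.2.1.1, d.1.1.2.1) * z (d.2.1.2, d.1.1.2.2) *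
            star (α d.2.2.2 (d.1.2.1, d.2.2.1) * w (d.2.2.1, d.1.2.2.1) *
              z (d.2.2.2, d.1.2.2.2))) := by
    rw [pairing_ketBra, ← Fintype.sum_prod_type']
    conv_rhs => rw [Fintype.sum_prod_type]
    refine Finset.sum_congr rfl fun d _ => ?_
    simp only [tensor, swapOuter, Matrix.of_apply, star_sum]
    rw [← Fintype.sum_prod_type', ← Fintype.sum_prod_type', Finset.sum_mul_sum, Finset.mul_sum]
    conv_rhs => rw [Fintype.sum_prod_type]
    refine Finset.sum_congr rfl fun e _ => ?_
    rw [Finset.mul_sum]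
    rfl
  have hR : pairing (flatten (compress α (biAmp φ x (flatten.symm (ketBra w))))) (ketBra z) =
      ∑ d : ((Fin r × Fin c) × (Fin r × Fin c)) × ((Fin p × Fin q) × (Fin p × Fin q)) ×
          (Fin b × Fin b),
        α d.1.1.1 d.2.1.1 * star (α d.1.2.1 d.2.1.2) *
          (w (d.2.1.1.2, d.2.2.1) * star (w (d.2.1.2.2, d.2.2.2)) *
            mapE φ (x d.2.1.1.1 d.2.1.2.1) (d.2.2.1, d.1.1.2) (d.2.2.2, d.1.2.2)) *
          (z d.1.1 * star (z d.1.2)) := by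
    rw [pairing_ketBra, ← Fintype.sum_prod_type']
    conv_rhs => rw [Fintype.sum_prod_type]
    refine Finset.sum_congr rfl fun d _ => ?_
    conv_rhs => rw [Fintype.sum_prod_type]
    simp only [flatten, Matrix.comp_apply, compress, biAmp, Matrix.of_apply, Matrix.sum_apply,
      Matrix.smul_apply, smul_eq_mul, mapE_linear_right φ,
      Matrix.comp_symm_apply, ketBra, Matrix.vecMulVec_apply, Pi.star_apply]
    rw [← Fintype.sum_prod_type', Finset.sum_mul]
    refine Finset.sum_congr rfl fun e _ => ?_
    rw [← Fintype.sum_prod_type', Finset.mul_sum, Finset.sum_mul]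
  rw [hL, hR]
  -- Both sides are now sums of the same monomials over all indices; the bijection matches their
  -- orderings.
  refine Fintype.sum_equiv
    { toFun := fun d => (((d.2.1.2, d.1.1.2.2), (d.2.2.2, d.1.2.2.2)),
        ((d.1.1.1, d.2.1.1), (d.1.2.1, d.2.2.1)), (d.1.1.2.1, d.1.2.2.1))
      invFun := fun d => (((d.2.1.1.1, d.2.2.1, d.1.1.2), (d.2.1.2.1, d.2.2.2, d.1.2.2)),
        (d.2.1.1.2, d.1.1.1), (d.2.1.2.2, d.1.2.1))
      left_inv := fun _ => rfl
      right_inv := fun _ => rfl } _ _ fun d => ?_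
  simp only [Equiv.coe_fn_mk, star_mul']
  ring

theorem isPositive_iff_pairing (φ : Bilin a b c) : IsPositive φ p q r ↔
    ∀ x : BlockMat p (Fin a), IsPos x → ∀ ξ : Fin p × Fin b × Fin c → ℂ, srB ξ ≤ q → srC ξ ≤ r →
      0 ≤ pairing (flatten (amp (mapE φ) x)) (ketBra ξ) := by
  rw [isPositive_iff_right]
  constructor
  · intro h x hx ξ hB hC
    obtain ⟨β, w, z, rfl⟩ := exists_eq_tensor hB hC
    have hβ : β = swapOuter (Matrix.of fun m s => β s.1 (s.2, m)) := rfl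
    rw [hβ, pairing_amp_mapE]
    exact posSemidef_iff_pairing_nonneg.mp (h x w _ hx) z
  · intro h x w α hx
    refine posSemidef_iff_pairing_nonneg.mpr fun z => ?_
    rw [← pairing_amp_mapE]
    exact h x hx _ (srB_tensor_le _ w z) (srC_tensor_le _ w z)

/-! ### Monotonicity and Hermiticity. -/

theorem IsPositive.mono {φ : Bilin a b c} (h : IsPositive φ p q r) {p' q' r' : ℕ}
    (hp : p' ≤ p) (hq : q' ≤ q) (hr : r' ≤ r) : IsPositive φ p' q' r' := by
  -- Each criterion fixes one parameter as the outer dimension and makes the other two rank bounds: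
  -- `p`, `q` are lowered through `D_φ`, then `r` through `E_φ`.
  have h1 : IsPositive φ p' q' r :=
    (isPositive_iff_schmidt φ).mpr fun ξ hB hC =>
      (isPositive_iff_schmidt φ).mp h ξ (hB.trans hp) (hC.trans hq)
  exact (isPositive_iff_pairing φ).mpr fun x hx ξ hB hC =>
    (isPositive_iff_pairing φ).mp h1 x hx ξ hB (hC.trans hr)

theorem isPos_one_iff {κ : Type} (x : BlockMat 1 κ) : IsPos x ↔ (x 0 0).PosSemidef := by
  have h : x 0 0 = (flatten x).submatrix (Equiv.uniqueProd κ (Fin 1)).symm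
      (Equiv.uniqueProd κ (Fin 1)).symm := rfl
  rw [h, Matrix.posSemidef_submatrix_equiv, IsPos]

theorem IsPositive.posSemidef_apply {φ : Bilin a b c} (h : IsPositive φ 1 1 1) {x : Mat (Fin a)}
    {y : Mat (Fin b)} (hx : x.PosSemidef) (hy : y.PosSemidef) : (φ x y).PosSemidef := by
  have := h (fun _ _ => x) (fun _ _ => y) (fun _ _ => 1) ((isPos_one_iff _).mpr hx)
    ((isPos_one_iff _).mpr hy)
  rw [isPos_one_iff] at this
  simpa [compress, biAmp] using this

theorem span_posSemidef {ι : Type} [Fintype ι] :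
    Submodule.span ℂ {X : Mat ι | X.PosSemidef} = ⊤ := by
  classical
  open scoped MatrixOrder Matrix.Norms.L2Operator in
  simpa only [Matrix.nonneg_iff_posSemidef] using CStarAlgebra.span_nonneg (A := Mat ι)

/-- Both sides are conjugate-linear in each variable, positive matrices span, and on positive pairs
all matrices involved are Hermitian. -/
theorem IsPositive.apply_conjTranspose {φ : Bilin a b c} (h : IsPositive φ 1 1 1) (x : Mat (Fin a))
    (y : Mat (Fin b)) : φ x.conjTranspose y.conjTranspose = (φ x y).conjTranspose := by
  have hx : x ∈ Submodule.span ℂ {X : Mat (Fin a) | X.PosSemidef} := by simp [span_posSemidef]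
  have hy : y ∈ Submodule.span ℂ {X : Mat (Fin b) | X.PosSemidef} := by simp [span_posSemidef]
  induction hx using Submodule.span_induction with
  | zero => simp
  | add x x' _ _ h1 h2 => simp [Matrix.conjTranspose_add, h1, h2]
  | smul t x _ h1 => simp [Matrix.conjTranspose_smul, h1]
  | mem x hx =>
    induction hy using Submodule.span_induction with
    | zero => simp
    | add y y' _ _ h1 h2 => simp [Matrix.conjTranspose_add, h1, h2]
    | smul t y _ h1 => simp [Matrix.conjTranspose_smul, h1]
    | mem y hy =>
      rw [hx.isHermitian.eq, hy.isHermitian.eq, (h.posSemidef_apply hx hy).isHermitian.eq]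

theorem IsPositive.isHermitian_amp_mapE {φ : Bilin a b c} (h : IsPositive φ 1 1 1) {n : ℕ}
    {x : BlockMat n (Fin a)} (hx : (flatten x).IsHermitian) :
    (flatten (amp (mapE φ) x)).IsHermitian := by
  ext ⟨i, k, m⟩ ⟨j, l, n⟩
  have h1 : (x j i).conjTranspose = x i j := by
    ext e f
    exact congrFun (congrFun hx (i, e)) (j, f)
  have h2 := h.apply_conjTranspose (x j i) (Matrix.single l k 1)
  rw [h1, Matrix.conjTranspose_single, star_one] at h2
  exact (congrFun (congrFun h2 m) n).symm

/-! ### State cones and the six equivalences. -/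

theorem ketBra_mem_stateCone {l m n p q r : ℕ} {ξ : Fin l × Fin m × Fin n → ℂ}
    (hA : srA ξ ≤ p) (hB : srB ξ ≤ q) (hC : srC ξ ≤ r) : ketBra ξ ∈ stateCone l m n p q r :=
  ⟨1, fun _ => ξ, fun _ => ⟨hA, hB, hC⟩, by simp⟩

theorem ketBra_mem_biStateCone {m n s : ℕ} {η : Fin m × Fin n → ℂ}
    (h : Module.finrank ℂ (LinearMap.range (lam η)) ≤ s) : ketBra η ∈ biStateCone m n s :=
  ⟨1, fun _ => η, fun _ => h, by simp⟩

theorem isBlockPos_iff {l m n p q r : ℕ} {W : Mat (Fin l × Fin m × Fin n)} :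
    IsBlockPos W p q r ↔ W.IsHermitian ∧ ∀ ξ, srA ξ ≤ p → srB ξ ≤ q → srC ξ ≤ r →
      0 ≤ pairing W (ketBra ξ) := by
  refine and_congr_right fun _ =>
    ⟨fun h ξ hA hB hC => h _ (ketBra_mem_stateCone hA hB hC), ?_⟩
  rintro h _ ⟨N, ξ, hξ, rfl⟩
  rw [pairing_sum_right]
  exact Finset.sum_nonneg fun i _ => h _ (hξ i).1 (hξ i).2.1 (hξ i).2.2

theorem isBiBlockPos_iff {m n s : ℕ} {W : Mat (Fin m × Fin n)} :
    IsBiBlockPos W s ↔ W.IsHermitian ∧ ∀ η, Module.finrank ℂ (LinearMap.range (lam η)) ≤ s →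
      0 ≤ pairing W (ketBra η) := by
  refine and_congr_right fun _ => ⟨fun h η hη => h _ (ketBra_mem_biStateCone hη), ?_⟩
  rintro h _ ⟨N, η, hη, rfl⟩
  rw [pairing_sum_right]
  exact Finset.sum_nonneg fun i _ => h _ (hη i)

theorem forall_fin_one {m n q r : ℕ} {P : (Fin 1 × Fin m × Fin n → ℂ) → Prop} :
    (∀ ξ, srB ξ ≤ q → srC ξ ≤ r → P ξ) ↔
      ∀ η : Fin m × Fin n → ℂ, Module.finrank ℂ (LinearMap.range (lam η)) ≤ min q r →
        P fun s => η s.2 := by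
  constructor
  · intro h η hη
    rw [le_min_iff] at hη
    exact h _ ((srB_one η).trans_le hη.1) ((srC_one η).trans_le hη.2)
  · intro h ξ hB hC
    obtain ⟨η, rfl⟩ : ∃ η : Fin m × Fin n → ℂ, ξ = fun s => η s.2 :=
      ⟨fun s => ξ (0, s), by ext ⟨i, s⟩; rw [Subsingleton.elim i 0]⟩
    exact h η (le_min (srB_one η ▸ hB) (srC_one η ▸ hC))

theorem isPositive_iff_stateCone (φ : Bilin a b c) : IsPositive φ p q r ↔
    ∀ ϱ ∈ stateCone r a b r p q, IsPos (amp (mapD φ) (flatten.symm ϱ)) := by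
  rw [isPositive_iff_schmidt]
  refine ⟨?_, fun h ξ hB hC => h _ (ketBra_mem_stateCone (srA_le ξ) hB hC)⟩
  rintro h _ ⟨N, ξ, hξ, rfl⟩
  have hsum : flatten (amp (mapD φ) (flatten.symm (∑ i, ketBra (ξ i)))) =
      ∑ i, flatten (amp (mapD φ) (flatten.symm (ketBra (ξ i)))) := by
    have : ∀ k l, (flatten.symm (∑ i, ketBra (ξ i)) : BlockMat r (Fin a × Fin b)) k l =
        ∑ i, (flatten.symm (ketBra (ξ i)) : BlockMat r (Fin a × Fin b)) k l := by
      intro k l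
      ext e f
      simp [flatten, Matrix.sum_apply]
    ext ⟨k, e⟩ ⟨l, f⟩
    simp only [Matrix.sum_apply, flatten, Matrix.comp_apply, amp, Matrix.map_apply] at this ⊢
    rw [this, map_sum, Matrix.sum_apply]
  rw [IsPos, hsum]
  exact Matrix.posSemidef_sum _ fun i _ => h _ (hξ i).2.1 (hξ i).2.2

theorem isPositive_iff_isBlockPos (φ : Bilin a b c) (hp : 1 ≤ p) (hq : 1 ≤ q) (hr : 1 ≤ r) :
    IsPositive φ p q r ↔
      ∀ x : BlockMat p (Fin a), IsPos x → IsBlockPos (flatten (amp (mapE φ) x)) p q r := by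
  simp only [isBlockPos_iff]
  constructor
  · intro h x hx
    -- Parameters at least one allow descent to `(1,1,1)`-positivity, which supplies the Hermitian
    -- half of block-positivity.
    exact ⟨(h.mono hp hq hr).isHermitian_amp_mapE hx.isHermitian,
      fun ξ _ => (isPositive_iff_pairing φ).mp h x hx ξ⟩
  · exact fun h => (isPositive_iff_pairing φ).mpr fun x hx ξ => (h x hx).2 ξ (srA_le ξ)

theorem srB_le {l m n : ℕ} (ξ : Fin l × Fin m × Fin n → ℂ) : srB ξ ≤ m :=
  (Submodule.finrank_le _).trans_eq finrank_euclideanSpace_fin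

theorem srC_le {l m n : ℕ} (ξ : Fin l × Fin m × Fin n → ℂ) : srC ξ ≤ n :=
  (Submodule.finrank_le _).trans_eq finrank_euclideanSpace_fin

theorem isPositive_iff_isSPositive_mapD (φ : Bilin a b c) :
    IsPositive φ a b r ↔ IsSPositive (mapD φ) r := by
  rw [isPositive_iff_schmidt]
  refine ⟨fun h x hx => ?_, fun h ξ _ _ => h _ (posSemidef_ketBra ξ)⟩
  refine isPos_induction (P := fun x => IsPos (amp (mapD φ) x)) ?_ ?_
    (fun ξ => h ξ (srB_le ξ) (srC_le ξ)) hx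
  · have : amp (mapD φ) (0 : BlockMat r (Fin a × Fin b)) = 0 := by ext i j : 2; simp [amp]
    rw [this]
    exact isPos_zero
  · intro x y h1 h2
    have : amp (mapD φ) (x + y) = amp (mapD φ) x + amp (mapD φ) y := by ext i j : 2; simp [amp]
    rw [this]
    exact h1.add h2

theorem isPositive_iff_isSPositive_mapE (φ : Bilin a b c) :
    IsPositive φ p b c ↔ IsSPositive (mapE φ) p := by
  rw [isPositive_iff_pairing]
  exact forall₂_congr fun x _ => ⟨fun h => posSemidef_iff_pairing_nonneg.mpr fun ξ =>
    h ξ (srB_le ξ) (srC_le ξ), fun h ξ _ _ => posSemidef_iff_pairing_nonneg.mp h ξ⟩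

theorem isPositive_iff_biStateCone (φ : Bilin a b c) : IsPositive φ p q 1 ↔
    ∀ ϱ ∈ biStateCone a b (min p q), (mapD φ ϱ).PosSemidef := by
  rw [isPositive_iff_schmidt, forall_fin_one]
  simp only [isPos_one_iff]
  constructor
  · rintro h _ ⟨N, η, hη, rfl⟩
    rw [map_sum]
    exact Matrix.posSemidef_sum _ fun i _ => h _ (hη i)
  · exact fun h η hη => h _ (ketBra_mem_biStateCone hη)

theorem pairing_fin_one (x : BlockMat 1 (Fin b × Fin c)) (η : Fin b × Fin c → ℂ) :
    pairing (flatten x) (ketBra fun s => η s.2) = pairing (x 0 0) (ketBra η) := by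
  simp only [pairing_ketBra]
  rw [Fintype.sum_prod_type, Fin.sum_univ_one]
  refine Finset.sum_congr rfl fun s _ => ?_
  rw [Fintype.sum_prod_type, Fin.sum_univ_one]
  rfl

theorem isPositive_iff_isBiBlockPos (φ : Bilin a b c) (hq : 1 ≤ q) (hr : 1 ≤ r) :
    IsPositive φ 1 q r ↔
      ∀ x : Mat (Fin a), x.PosSemidef → IsBiBlockPos (mapE φ x) (min q r) := by
  have key : IsPositive φ 1 q r ↔ ∀ x : Mat (Fin a), x.PosSemidef →
      ∀ η : Fin b × Fin c → ℂ, Module.finrank ℂ (LinearMap.range (lam η)) ≤ min q r →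
        0 ≤ pairing (mapE φ x) (ketBra η) := by
    rw [isPositive_iff_pairing]
    simp only [forall_fin_one, pairing_fin_one, isPos_one_iff]
    exact ⟨fun h x => h fun _ _ => x, fun h x => h (x 0 0)⟩
  simp only [isBiBlockPos_iff]
  refine ⟨fun h x hx => ⟨?_, key.mp h x hx⟩, fun h => key.mpr fun x hx => (h x hx).2⟩
  have := (h.mono le_rfl hq hr).isHermitian_amp_mapE (x := fun _ _ : Fin 1 => x)
    ((isPos_one_iff _).mpr hx).isHermitian
  -- The single block of the `1 × 1` block matrix is `mapE φ x`.
  exact this.submatrix fun s => ((0 : Fin 1), s)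

end TriPos

theorem mainTheorem9 (a b c : ℕ) (φ : Bilin a b c)
    (p q r : ℕ) (hp : 1 ≤ p) (hq : 1 ≤ q) (hr : 1 ≤ r) :
    (IsPositive φ p q r ↔
      ∀ ϱ ∈ stateCone r a b r p q, IsPos (amp (mapD φ) (flatten.symm ϱ))) ∧
    (IsPositive φ p q r ↔
      ∀ x : BlockMat p (Fin a), IsPos x → IsBlockPos (flatten (amp (mapE φ) x)) p q r) ∧
    (IsPositive φ a b r ↔ IsSPositive (mapD φ) r) ∧
    (IsPositive φ p q 1 ↔
      ∀ ϱ ∈ biStateCone a b (min p q), (mapD φ ϱ).PosSemidef) ∧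
    (IsPositive φ p b c ↔ IsSPositive (mapE φ) p) ∧
    (IsPositive φ 1 q r ↔
      ∀ x : Mat (Fin a), x.PosSemidef → IsBiBlockPos (mapE φ x) (min q r)) :=
  ⟨isPositive_iff_stateCone φ, isPositive_iff_isBlockPos φ hp hq hr,
    isPositive_iff_isSPositive_mapD φ, isPositive_iff_biStateCone φ,
    isPositive_iff_isSPositive_mapE φ, isPositive_iff_isBiBlockPos φ hq hr⟩
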